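/- Let $Q=(Q_0,Q_1)$ be a finite quiver, let $W$ be a potential on $Q$ (a complex linear combination of cycles), and let $J=J(Q,W)$ be the Jacobian algebra. Let $\chi_Q(d,d')=\sum_i d_id'_i-\sum_{a:i\to j}d_id'_j$ be the Euler form on $\mathbb Z^{Q_0}$ and $\langle d,d'\rangle=\chi_Q(d,d')-\chi_Q(d',d)$. For a complex variety $X$ with a regular function $f$, let $P(X,f;y)\in\mathbb Z[y]$ be the weight polynomial of the exponential motivic class of $(X,f)$: the isomorphism invariant that is additive with respect to complements and satisfies $P(X,f;y)=\sum_k\dim H^k(X,f^{-1}(t);\mathbb Q)\,(-y)^k$ for generic $t\in\mathbb C$, if $X$ is smooth and $f:X\to\mathbb A^1$ is proper. For $f=0$ this is the virtual Poincaré polynomial $P(X;y)$. For a weight $\theta\in\mathbb R^{Q_0}$ and $d\in\mathbb N^{Q_0}$ with $\theta(d)=\sum_i\theta_id_i=0$, let $R^\theta(Q,d)\subset R(Q,d)=\bigoplus_{a:i\to j}\mathrm{Hom}(\mathbb C^{d_i},\mathbb C^{d_j})$ be the open subset of $\theta$-semistable representations, that is, those with $\theta(\underline{\dim}N)\le0$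 for all subrepresentations $N$; let $R^\theta(J,d)$ be its closed subset of representations of $J$, let $G_d=\prod_i\mathrm{GL}_{d_i}(\mathbb C)$, and let $\omega_d=\mathrm{tr}(W|-)$. Define the stacky invariants $$\mathcal A_\theta(d,y)=(-y)^{\chi_Q(d,d)}\frac{P(R^\theta(Q,d),\omega_d;y)}{P(G_d;y)}\in\mathbb Q(y).$$ A weight $\theta$ is called generic if $\{n\in\mathbb Z^{Q_0}:\theta(n)=0\}$ has rank one. For generic $\theta$ the invariants $\Omega_\theta(d,y)\in\mathbb Q(y)$, for $\theta(d)=0$, are defined by $$\sum_{\theta(d)=0}\mathcal A_\theta(d,y)x^d=\mathrm{Exp}\left(\frac{\sum_{\theta(d)=0}\Omega_\theta(d,y)x^d}{y^{-1}-y}\right),$$ where $\mathrm{Exp}(f)=\exp\left(\sum_{m\ge1}\frac1m f(y^m,x^m)\right)$. The attractor invariant $\Omega_*(d,y)$ is the common value of $\Omega_\theta(d,y)$ for all generic $\theta$ in $d^\perp=\{\theta:\theta(d)=0\}$ sufficiently close to the weight $\langle-,d\rangle$. **Theorem.** Let $d\in\mathbb N^{Q_0}$, and let $Q|_{\mathrm{supp}(d)}$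 be the full subquiver of $Q$ on $\mathrm{supp}(d)=\{i\in Q_0:d_i\ne0\}$. If $Q|_{\mathrm{supp}(d)}$ is not strongly connected (there are vertices $i,j$ in it without a path from $i$ to $j$), then $\Omega_*(d,y)=0$; more precisely, $\Omega_\theta(d,y)=0$ for all generic $\theta\in d^\perp$ sufficiently close to $\langle-,d\rangle$. The same holds if $P(R^\theta(Q,d),\omega_d;y)$ is replaced by $P(R^\theta(J,d);y)$ in the definition of $\mathcal A_\theta(d,y)$. -/

import Mathlib

open CategoryTheory AlgebraicGeometry Polynomial Filter Topology

noncomputable section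

namespace AttractorDT

/-! ### Singular cohomology of a pair -/

section Singular

variable (X : Type) [TopologicalSpace X]

/-- Singular `k`-simplices of `X`. -/
abbrev SingularSimplex (k : ℕ) : Type := C(stdSimplex ℝ (Fin (k + 1)), X)

variable {X} in
/-- The `i`-th face of a singular simplex. -/
def SingularSimplex.face {k : ℕ} (i : Fin (k + 2)) (σ : SingularSimplex X (k + 1)) :
    SingularSimplex X k :=
  σ.comp ⟨stdSimplex.map (Fin.succAbove i), stdSimplex.continuous_map _⟩

/-- The singular coboundary `(δφ)(σ) = ∑ i, (-1) ^ i φ(dᵢ σ)`, with rational coefficients. -/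
def coboundary (k : ℕ) : (SingularSimplex X k → ℚ) →ₗ[ℚ] (SingularSimplex X (k + 1) → ℚ) where
  toFun φ σ := ∑ i : Fin (k + 2), (-1 : ℚ) ^ (i : ℕ) * φ (σ.face i)
  map_add' φ ψ := by
    funext σ
    simp [mul_add, Finset.sum_add_distrib]
  map_smul' c φ := by
    funext σ
    simp only [Pi.smul_apply, smul_eq_mul, RingHom.id_apply, Finset.mul_sum]
    exact Finset.sum_congr rfl fun i _ => by ring

variable {X}

/-- Relative cochains of `(X, A)`: the cochains vanishing on the simplices contained in `A`. -/
def relCochains (A : Set X) (k : ℕ) : Submodule ℚ (SingularSimplex X k → ℚ) where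
  carrier := {φ | ∀ σ : SingularSimplex X k, (∀ p, σ p ∈ A) → φ σ = 0}
  zero_mem' := fun _ _ => rfl
  add_mem' := fun hφ hψ σ hσ => by simp [hφ σ hσ, hψ σ hσ]
  smul_mem' := fun c φ hφ σ hσ => by simp [hφ σ hσ]

/-- Relative cocycles of degree `k`. -/
def relCocycles (A : Set X) (k : ℕ) : Submodule ℚ (SingularSimplex X k → ℚ) :=
  relCochains A k ⊓ LinearMap.ker (coboundary X k)

/-- Relative coboundaries of degree `k`. -/
def relCoboundaries (A : Set X) : (k : ℕ) → Submodule ℚ (SingularSimplex X k → ℚ)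
  | 0 => ⊥
  | k + 1 => (relCochains A k).map (coboundary X k)

/-- The dimension of the relative singular cohomology `H^k(X, A; ℚ)`. -/
def relBetti (A : Set X) (k : ℕ) : ℕ :=
  Module.finrank ℚ
    (relCocycles A k ⧸ (relCoboundaries A k).comap (relCocycles A k).subtype)

end Singular

/-! ### Complex varieties with a regular function, and the virtual Poincaré polynomial -/

/-- The affine line over `ℂ`. An object `X` of `Over affineLine` is a complex scheme together with
a regular function `X.hom : X ⟶ 𝔸¹`. -/
abbrev affineLine : Scheme.{0} := Spec (CommRingCat.of ℂ[X])

/-- The structure morphism of the affine line. -/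
def affineLine.structure : affineLine ⟶ Spec (CommRingCat.of ℂ) :=
  Spec.map (CommRingCat.ofHom (Polynomial.C : ℂ →+* ℂ[X]))

/-- The complex point `t` of the affine line. -/
def affineLine.point (t : ℂ) : Spec (CommRingCat.of ℂ) ⟶ affineLine :=
  Spec.map (CommRingCat.ofHom (Polynomial.evalRingHom t))

/-- `X` is a complex variety (separated and of finite type over `ℂ`). -/
structure IsVariety (X : Over affineLine) : Prop where
  locallyOfFiniteType : LocallyOfFiniteType (X.hom ≫ affineLine.structure)
  quasiCompact : QuasiCompact (X.hom ≫ affineLine.structure)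
  isSeparated : IsSeparated (X.hom ≫ affineLine.structure)

/-- The complex points of `X`. -/
def CPoint (X : Over affineLine) : Type :=
  {x : Spec (CommRingCat.of ℂ) ⟶ X.left // x ≫ X.hom ≫ affineLine.structure = 𝟙 _}

/-- The value of a global function at a complex point. -/
def evalPoint {U : Scheme.{0}} (y : Spec (CommRingCat.of ℂ) ⟶ U) (s : Γ(U, ⊤)) : ℂ :=
  (Scheme.ΓSpecIso (CommRingCat.of ℂ)).hom.hom (y.appTop.hom s)

/-- The analytic topology on `X(ℂ)`: it is generated by the sets `{x ∈ U(ℂ) | s(x) ∈ V}` for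
`U ⊆ X` Zariski open, `s` a regular function on `U` and `V ⊆ ℂ` open. -/
instance CPoint.analyticTopology (X : Over affineLine) : TopologicalSpace (CPoint X) :=
  TopologicalSpace.generateFrom
    {T | ∃ (U : X.left.Opens) (s : Γ((U : Scheme.{0}), ⊤)) (V : Set ℂ), IsOpen V ∧
      T = {x | ∃ y : Spec (CommRingCat.of ℂ) ⟶ (U : Scheme.{0}),
        y ≫ U.ι = x.1 ∧ evalPoint y s ∈ V}}

/-- The fibre over `t` of the function `X(ℂ) → ℂ`. -/
def CPoint.fibre (X : Over affineLine) (t : ℂ) : Set (CPoint X) :=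
  {x | x.1 ≫ X.hom = affineLine.point t}

/-- The characterization of the virtual Poincaré polynomial `P(X, f; y)` of complex varieties `X`
with a regular function `f : X → 𝔸¹` (the weight polynomial of the exponential motivic class).
It is invariant under isomorphisms, additive with respect to complements, and if `X` is smooth and
`f` is proper, then `P(X, f; y) = ∑ₖ dim H^k(X(ℂ), f⁻¹(t); ℚ) (-y)^k` for generic `t`. In
particular, for `f = 0` and `X` smooth and proper, it is `∑ₖ dim H^k(X(ℂ), ℚ) (-y)^k`, so that
`X ↦ P(X, 0; y)` is the usual virtual Poincaré polynomial. -/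
structure IsVirtualPoincare (P : Over affineLine → ℤ[X]) : Prop where
  iso_invariant : ∀ X Y : Over affineLine, IsVariety X → IsVariety Y → Nonempty (X ≅ Y) → P X = P Y
  additive : ∀ (X Z U : Over affineLine) (i : Z ⟶ X) (j : U ⟶ X), IsVariety X →
    IsClosedImmersion i.left → IsOpenImmersion j.left →
    Set.range j.left = (Set.range i.left)ᶜ → P X = P Z + P U
  smooth_proper : ∀ X : Over affineLine, IsVariety X →
    Smooth (X.hom ≫ affineLine.structure) → IsProper X.hom →
    ∀ k : ℕ, ∀ᶠ t : ℂ in cofinite,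
      (P X).coeff k = (-1) ^ k * (relBetti (CPoint.fibre X t) k : ℤ)

open Classical in
/-- The virtual Poincaré polynomial `P(X, f; y)`: the function with the above properties. It is
unique on varieties, as the classes of the smooth `X` with proper `f` generate the Grothendieck
group of varieties over `𝔸¹`. -/
def virtualPoincare : Over affineLine → ℤ[X] :=
  if h : ∃ P, IsVirtualPoincare P then h.choose else 0

/-- `P(X, f; y)` as an element of the field `ℚ(y)`. -/
def poincare (X : Over affineLine) : RatFunc ℚ :=
  algebraMap ℚ[X] (RatFunc ℚ) ((virtualPoincare X).map (Int.castRingHom ℚ))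

/-! ### Quivers with potential and spaces of representations -/

section QuiverWithPotential

variable {V : Type} [Fintype V] [DecidableEq V] [Quiver.{0} V] [∀ i j : V, Fintype (i ⟶ j)]

/-- A potential: a linear combination of cycles. -/
abbrev Potential (V : Type) [Quiver.{0} V] : Type := (Σ i : V, Quiver.Path i i) →₀ ℂ

/-- The cyclic derivative of a cycle with respect to an arrow `a : j ⟶ k`: the sum, over all ways
of writing the cycle as "first `u`, then `a`, then `v`", of the paths "first `v`, then `u`". -/
def cycleDeriv {i j k : V} (p : Quiver.Path i i) (a : j ⟶ k) : Quiver.Path k j →₀ ℂ :=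
  ∑ᶠ uv ∈ {uv : Quiver.Path i j × Quiver.Path k i | (uv.1.cons a).comp uv.2 = p},
    Finsupp.single (uv.2.comp uv.1) 1

/-- The cyclic derivative `∂W/∂a` of a potential. -/
def potentialDeriv (W : Potential V) {j k : V} (a : j ⟶ k) : Quiver.Path k j →₀ ℂ :=
  W.sum fun p c => c • cycleDeriv p.2 a

/-- The coordinates on `R(Q, d)`: the matrix entries of all arrows. -/
abbrev Coord (d : V →₀ ℕ) : Type := Σ (i j : V), (i ⟶ j) × Fin (d j) × Fin (d i)

/-- The matrix of an arrow, in the representation with coordinates `x`. -/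
def arrowMatrix {R : Type} (d : V →₀ ℕ) (x : Coord d → R) {i j : V} (a : i ⟶ j) :
    Matrix (Fin (d j)) (Fin (d i)) R :=
  Matrix.of fun p q => x ⟨i, j, a, p, q⟩

/-- The matrix of a path, in the representation with coordinates `x`. -/
def pathMatrix {R : Type} [CommRing R] (d : V →₀ ℕ) (x : Coord d → R) {i : V} :
    {j : V} → Quiver.Path i j → Matrix (Fin (d j)) (Fin (d i)) R
  | _, .nil => 1
  | _, .cons p a => arrowMatrix d x a * pathMatrix d x p

/-- The coordinate ring of the affine space `R(Q, d)`. -/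
abbrev RepRing (d : V →₀ ℕ) : Type := MvPolynomial (Coord d) ℂ

/-- The function `ω_d = tr(W | -)` on `R(Q, d)`. -/
def traceFunction (W : Potential V) (d : V →₀ ℕ) : RepRing d :=
  W.sum fun p c => MvPolynomial.C c * (pathMatrix d MvPolynomial.X p.2).trace

/-- The ideal of the closed subscheme `R(J, d) ⊆ R(Q, d)` of representations of the Jacobian
algebra: it is generated by the matrix entries of the relations `∂W/∂a`, for all arrows `a`. -/
def jacobianIdeal (W : Potential V) (d : V →₀ ℕ) : Ideal (RepRing d) :=
  Ideal.span {f | ∃ (j k : V) (a : j ⟶ k) (p : Fin (d j)) (q : Fin (d k)),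
    f = ((potentialDeriv W a).sum fun path c =>
      (MvPolynomial.C c : RepRing d) • pathMatrix d MvPolynomial.X path) p q}

/-! ### Stability -/

/-- The value `θ(n) = ∑ i, θ i * n i` of a weight on a dimension vector. -/
def weightValue (θ : V → ℝ) (n : V → ℕ) : ℝ := ∑ i, θ i * n i

/-- A weight is generic if its kernel on `ℤ^{Q₀}` has rank one. -/
def IsGenericWeight (θ : V → ℝ) : Prop :=
  Module.finrank ℤ (LinearMap.ker (Fintype.linearCombination ℤ θ)) = 1

/-- `θ`-semistability of the complex representation with coordinates `x`: `θ(M) = 0`, and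
`θ(N) ≤ 0` for every subrepresentation `N`. -/
def IsSemistable (θ : V → ℝ) (d : V →₀ ℕ) (x : Coord d → ℂ) : Prop :=
  weightValue θ d = 0 ∧
    ∀ N : ∀ i : V, Submodule ℂ (Fin (d i) → ℂ),
      (∀ (i j : V) (a : i ⟶ j), (N i).map (arrowMatrix d x a).mulVecLin ≤ N j) →
      weightValue θ (fun i => Module.finrank ℂ (N i)) ≤ 0

/-- The point of `R(Q, d)` with coordinates `x`. -/
def repPoint (d : V →₀ ℕ) (x : Coord d → ℂ) : Spec (CommRingCat.of (RepRing d)) :=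
  PrimeSpectrum.comap (MvPolynomial.eval x) ⊥

/-- The Zariski open subset `R^θ(Q, d) ⊆ R(Q, d)` of semistable representations: the complement of
the (closed) locus of representations that are not semistable. -/
def semistableLocus (θ : V → ℝ) (d : V →₀ ℕ) : (Spec (CommRingCat.of (RepRing d))).Opens :=
  ⟨(closure {z | ∃ x, z = repPoint d x ∧ ¬ IsSemistable θ d x})ᶜ, isClosed_closure.isOpen_compl⟩

/-- `R^θ(Q, d)` with the function `ω_d`. -/
def semistableReps (W : Potential V) (θ : V → ℝ) (d : V →₀ ℕ) : Over affineLine :=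
  Over.mk ((semistableLocus θ d).ι ≫
    Spec.map (CommRingCat.ofHom (Polynomial.aeval (R := ℂ) (traceFunction W d)).toRingHom))

/-- `R^θ(J, d) = R(J, d) ∩ R^θ(Q, d)` with the zero function. -/
def semistableJacobianReps (W : Potential V) (θ : V → ℝ) (d : V →₀ ℕ) : Over affineLine :=
  Over.mk ((Spec.map (CommRingCat.ofHom (Ideal.Quotient.mk (jacobianIdeal W d))) ⁻¹ᵁ
      semistableLocus θ d).ι ≫
    Spec.map (CommRingCat.ofHom
      (Polynomial.aeval (R := ℂ) (0 : RepRing d ⧸ jacobianIdeal W d)).toRingHom))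

/-- The coordinate ring of `∏ i, Mat_{d i}`. -/
abbrev GaugeRing (d : V →₀ ℕ) : Type := MvPolynomial (Σ i : V, Fin (d i) × Fin (d i)) ℂ

/-- The function `g ↦ ∏ i, det (g i)`. -/
def gaugeDet (d : V →₀ ℕ) : GaugeRing d :=
  ∏ i : V, (Matrix.of fun p q : Fin (d i) => (MvPolynomial.X ⟨i, p, q⟩ : GaugeRing d)).det

/-- The open subset `G_d = ∏ i, GL_{d i} ⊆ ∏ i, Mat_{d i}`. -/
def gaugeLocus (d : V →₀ ℕ) : (Spec (CommRingCat.of (GaugeRing d))).Opens :=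
  PrimeSpectrum.basicOpen (gaugeDet d)

/-- The group `G_d` as a variety, with the zero function. -/
def gaugeGroup (d : V →₀ ℕ) : Over affineLine :=
  Over.mk ((gaugeLocus d).ι ≫
    Spec.map (CommRingCat.ofHom (Polynomial.aeval (R := ℂ) (0 : GaugeRing d)).toRingHom))

/-- The Euler form `χ_Q(d, d') = ∑ i, d i * d' i - ∑ (a : i ⟶ j), d i * d' j`. -/
def eulerForm (d d' : V → ℤ) : ℤ :=
  ∑ i, d i * d' i - ∑ i, ∑ j, (Fintype.card (i ⟶ j) : ℤ) * (d i * d' j)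

/-- The skew-symmetrized Euler form. -/
def skewForm (d d' : V → ℤ) : ℤ := eulerForm d d' - eulerForm d' d

/-! ### Stacky, integer and attractor invariants -/

/-- The stacky invariant `𝒜_θ(d, y) = (-y)^{χ_Q(d, d)} P(R^θ(Q, d), ω_d; y) / P(G_d; y)`, through
the exponential motivic class of `ω_d = tr(W | -)`. -/
def stackyDT (W : Potential V) (θ : V → ℝ) (d : V →₀ ℕ) : RatFunc ℚ :=
  (-RatFunc.X) ^ eulerForm (fun i => (d i : ℤ)) (fun i => (d i : ℤ)) *
    (poincare (semistableReps W θ d) / poincare (gaugeGroup d))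

/-- The variant `(-y)^{χ_Q(d, d)} P(R^θ(J, d); y) / P(G_d; y)` of the stacky invariant, through the
critical locus `R^θ(J, d)` of `ω_d`. -/
def criticalStackyDT (W : Potential V) (θ : V → ℝ) (d : V →₀ ℕ) : RatFunc ℚ :=
  (-RatFunc.X) ^ eulerForm (fun i => (d i : ℤ)) (fun i => (d i : ℤ)) *
    (poincare (semistableJacobianReps W θ d) / poincare (gaugeGroup d))

/-- The Adams operation `F(y, x) ↦ F(y^m, x^m)`. -/
def adams (m : ℕ) (F : MvPowerSeries V (RatFunc ℚ)) : MvPowerSeries V (RatFunc ℚ) := fun d =>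
  if ∀ i, m ∣ d i then
    RatFunc.eval (algebraMap ℚ (RatFunc ℚ)) (RatFunc.X ^ m)
      (MvPowerSeries.coeff (d.mapRange (· / m) (Nat.zero_div m)) F)
  else 0

/-- The logarithm `log F = ∑ n ≥ 1, (-1)^(n-1) / n * (F - 1)^n` of a series with constant term `1`;
the terms with `n > |d|` do not contribute to the coefficient of `x^d`. -/
def seriesLog (F : MvPowerSeries V (RatFunc ℚ)) : MvPowerSeries V (RatFunc ℚ) := fun d =>
  ∑ n ∈ Finset.Icc 1 d.degree,
    ((-1) ^ (n - 1) / (n : RatFunc ℚ)) * MvPowerSeries.coeff d ((F - 1) ^ n)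

/-- The plethystic logarithm `Log F = ∑ m ≥ 1, μ(m) / m * log F(y^m, x^m)`, the inverse of the
plethystic exponential; the terms with `m > |d|` do not contribute to the coefficient of `x^d`. -/
def plethysticLog (F : MvPowerSeries V (RatFunc ℚ)) : MvPowerSeries V (RatFunc ℚ) := fun d =>
  ∑ m ∈ Finset.Icc 1 d.degree,
    ((ArithmeticFunction.moebius m : RatFunc ℚ) / (m : RatFunc ℚ)) *
      MvPowerSeries.coeff d (seriesLog (adams m F))

open Classical in
/-- The generating series `∑_{θ(d) = 0} 𝒜_θ(d, y) x^d` of a system of stacky invariants. -/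
def stackySeries (A : (V → ℝ) → (V →₀ ℕ) → RatFunc ℚ) (θ : V → ℝ) :
    MvPowerSeries V (RatFunc ℚ) := fun d =>
  if weightValue θ d = 0 then A θ d else 0

/-- The integer DT invariants for a generic weight `θ` and `θ(d) = 0`, defined by
`∑ 𝒜_θ(d, y) x^d = Exp ((∑ Ω_θ(d, y) x^d) / (y⁻¹ - y))`. -/
def integerDT (A : (V → ℝ) → (V →₀ ℕ) → RatFunc ℚ) (θ : V → ℝ) (d : V →₀ ℕ) : RatFunc ℚ :=
  (RatFunc.X⁻¹ - RatFunc.X) * MvPowerSeries.coeff d (plethysticLog (stackySeries A θ))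

/-- The self-stability weight `⟨-, d⟩`. -/
def selfStability (d : V →₀ ℕ) : V → ℝ := fun i =>
  (skewForm (Pi.single i 1) (fun j => (d j : ℤ)) : ℝ)

/-- The filter of generic perturbations of the self-stability `⟨-, d⟩` inside `d^⊥`. -/
def attractorFilter (d : V →₀ ℕ) : Filter (V → ℝ) :=
  𝓝[{θ | weightValue θ d = 0 ∧ IsGenericWeight θ}] (selfStability d)

/-- The attractor invariant `Ω_*(d, y)`: the common value of `Ω_θ(d, y)` for all sufficiently small
generic perturbations `θ ∈ d^⊥` of the self-stability `⟨-, d⟩`. -/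
def attractorDT (A : (V → ℝ) → (V →₀ ℕ) → RatFunc ℚ) (d : V →₀ ℕ) : RatFunc ℚ :=
  Classical.epsilon fun v => ∀ᶠ θ in attractorFilter d, integerDT A θ d = v

/-- The vertices of the full subquiver `Q|_{supp(d)}`. -/
def SuppQuiver (d : V →₀ ℕ) : Type := {i : V // i ∈ d.support}

instance (d : V →₀ ℕ) : Quiver.{0} (SuppQuiver d) where
  Hom i j := (i.1 ⟶ j.1)

end QuiverWithPotential

end AttractorDT

end

open CategoryTheory AlgebraicGeometry Polynomial Filter Topology

set_option linter.unusedSectionVars false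

namespace AttractorDT

/-! ### The virtual Poincaré polynomial of the empty variety -/

/-! If the support quiver is not strongly connected, its vertices reachable from a suitable vertex
form a set `I` that meets the support, misses part of it, and has no outgoing arrow within it. Every
representation of dimension `d` then has a subrepresentation of dimension `d|_I`. The number `⟨d|_I,
d⟩` is the sum of `d k * d l` over the arrows `k ⟶ l` entering `I`. If it is positive, it stays
positive for nearby `θ`, and `I` destabilizes everything. Otherwise the support splits into two
parts without arrows between them; genericity forces `θ(d|_I) ≠ 0`, so one of the two parts
destabilizes.

For generic `θ`, every `e ≠ 0` with `θ(e) = 0` is proportional to `d`, so the same set destabilizes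
all representations of dimension `e` (`eventually_not_isSemistable`). Hence the semistable loci are
empty, the generating series is constant, and its plethystic logarithm vanishes in degree `d`. The
potential plays no role, which is why both versions of the invariants vanish. Density of generic
weights in `d^⊥` (`mem_closure_isGenericWeight`) makes the attractor invariant a well-defined value.
-/

theorem isVariety_of_isEmpty (X : Over affineLine) [IsEmpty X.left] : IsVariety X where
  locallyOfFiniteType := inferInstance
  quasiCompact := inferInstance
  isSeparated := inferInstance

/-- Additivity for the decomposition of the empty variety into two copies of itself gives `P = P +
P`. If no `P` with the required properties existed, the default value would be `0` as well. -/
theorem virtualPoincare_of_isEmpty (X : Over affineLine) [IsEmpty X.left] :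
    virtualPoincare X = 0 := by
  unfold virtualPoincare
  split_ifs with h
  · have hX := h.choose_spec.additive X X X (𝟙 X) (𝟙 X) (isVariety_of_isEmpty X)
      (by rw [Over.id_left]; infer_instance) (by rw [Over.id_left]; infer_instance)
      (Set.ext fun x => isEmptyElim x)
    simpa using hX
  · rfl

theorem poincare_of_isEmpty (X : Over affineLine) [IsEmpty X.left] : poincare X = 0 := by
  simp [poincare, virtualPoincare_of_isEmpty X]

section QuiverWithPotential

variable {V : Type} [Fintype V] [DecidableEq V] [Quiver.{0} V] [∀ i j : V, Fintype (i ⟶ j)]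

/-! ### Emptiness of the semistable locus -/

/-- The complex points are dense in the affine space `R(Q, d)`. -/
theorem closure_range_repPoint (d : V →₀ ℕ) : closure (Set.range (repPoint d)) = Set.univ := by
  have h : PrimeSpectrum.vanishingIdeal (Set.range (repPoint d)) = ⊥ := by
    -- A polynomial vanishing at all complex points is zero, as `ℂ` is infinite.
    refine (Submodule.eq_bot_iff _).2 fun f hf => MvPolynomial.funext fun x => ?_
    have := (PrimeSpectrum.mem_vanishingIdeal _ _).1 hf _ ⟨x, rfl⟩
    simpa [repPoint] using this
  have h' := PrimeSpectrum.zeroLocus_vanishingIdeal_eq_closure (Set.range (repPoint d))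
  rw [h] at h'
  exact h'.symm.trans PrimeSpectrum.zeroLocus_bot

theorem semistableLocus_eq_bot {θ : V → ℝ} {d : V →₀ ℕ} (h : ∀ x, ¬ IsSemistable θ d x) :
    semistableLocus θ d = ⊥ := by
  have hs : {z | ∃ x, z = repPoint d x ∧ ¬ IsSemistable θ d x} = Set.range (repPoint d) :=
    Set.ext fun z => ⟨fun ⟨x, hx, _⟩ => ⟨x, hx.symm⟩, fun ⟨x, hx⟩ => ⟨x, hx.symm, h x⟩⟩
  refine TopologicalSpace.Opens.ext ?_
  change (closure _)ᶜ = ∅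
  rw [hs, closure_range_repPoint, Set.compl_univ]

theorem stackyDT_eq_zero (W : Potential V) {θ : V → ℝ} {d : V →₀ ℕ}
    (h : ∀ x, ¬ IsSemistable θ d x) : stackyDT W θ d = 0 := by
  have : IsEmpty (semistableReps W θ d).left :=
    ⟨fun z => by simpa [semistableLocus_eq_bot h] using z.2⟩
  simp [stackyDT, poincare_of_isEmpty]

theorem criticalStackyDT_eq_zero (W : Potential V) {θ : V → ℝ} {d : V →₀ ℕ}
    (h : ∀ x, ¬ IsSemistable θ d x) : criticalStackyDT W θ d = 0 := by
  have : IsEmpty (semistableJacobianReps W θ d).left :=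
    ⟨fun z => by simpa [semistableLocus_eq_bot h] using z.2⟩
  simp [criticalStackyDT, poincare_of_isEmpty]

/-! ### Plethystic logarithms of constant series -/

/-- The new constant is left unspecified, since only coefficients of nonzero degree matter
afterwards. -/
theorem adams_C (m : ℕ) (c : RatFunc ℚ) :
    ∃ c', adams m (MvPowerSeries.C (σ := V) c) = MvPowerSeries.C c' := by
  refine ⟨RatFunc.eval (algebraMap ℚ (RatFunc ℚ)) (RatFunc.X ^ m) c, MvPowerSeries.ext fun d => ?_⟩
  change (if ∀ i, m ∣ d i then _ else _) = _
  rw [MvPowerSeries.coeff_C, MvPowerSeries.coeff_C]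
  have hd : d.mapRange (· / m) (Nat.zero_div m) = 0 → (∀ i, m ∣ d i) → d = 0 := fun h hdvd =>
    Finsupp.ext fun i => by
      have := DFunLike.congr_fun h i
      simp only [Finsupp.mapRange_apply, Finsupp.coe_zero, Pi.zero_apply] at this
      rw [← Nat.div_mul_cancel (hdvd i), this, zero_mul, Finsupp.coe_zero, Pi.zero_apply]
  by_cases h0 : d = 0
  · subst h0
    simp
  · rw [if_neg h0]
    split_ifs with h1 h2
    · exact absurd (hd h2 h1) h0
    · simp
    · rfl

theorem seriesLog_C (c : RatFunc ℚ) {d : V →₀ ℕ} (hd : d ≠ 0) :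
    MvPowerSeries.coeff d (seriesLog (MvPowerSeries.C (σ := V) c)) = 0 := by
  change ∑ n ∈ Finset.Icc 1 d.degree, _ = _
  refine Finset.sum_eq_zero fun n _ => ?_
  rw [← map_one (MvPowerSeries.C (σ := V)), ← map_sub, ← map_pow, MvPowerSeries.coeff_C, if_neg hd,
    mul_zero]

theorem plethysticLog_C (c : RatFunc ℚ) {d : V →₀ ℕ} (hd : d ≠ 0) :
    MvPowerSeries.coeff d (plethysticLog (MvPowerSeries.C (σ := V) c)) = 0 := by
  change ∑ m ∈ Finset.Icc 1 d.degree, _ = _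
  refine Finset.sum_eq_zero fun m _ => ?_
  obtain ⟨c', hc'⟩ := adams_C (V := V) m c
  rw [hc', seriesLog_C c' hd, mul_zero]

/-- The series reduces to its constant term, which need not be known to be `1`: every constant
series has vanishing `plethysticLog` in nonzero degree. -/
theorem integerDT_eq_zero {A : (V → ℝ) → (V →₀ ℕ) → RatFunc ℚ} {θ : V → ℝ}
    (h : ∀ e : V →₀ ℕ, e ≠ 0 → weightValue θ e = 0 → A θ e = 0) {d : V →₀ ℕ} (hd : d ≠ 0) :
    integerDT A θ d = 0 := by
  have hF : stackySeries A θ = MvPowerSeries.C (stackySeries A θ 0) := by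
    refine MvPowerSeries.ext fun e => ?_
    rw [MvPowerSeries.coeff_C]
    split_ifs with he
    · rw [he]; rfl
    · change (if _ then _ else _) = _
      split_ifs with hθ
      · exact h e he hθ
      · rfl
  rw [integerDT, hF, plethysticLog_C _ hd, mul_zero]

/-! ### Generic weights -/

theorem linearCombination_eq_weightValue (θ : V → ℝ) (n : V → ℕ) :
    Fintype.linearCombination ℤ θ (fun i => (n i : ℤ)) = weightValue θ n := by
  simp [Fintype.linearCombination_apply, weightValue, mul_comm]

/-- Two dimension vectors in the kernel of a generic weight are proportional. -/
theorem IsGenericWeight.exists_mul_eq {θ : V → ℝ} (hθ : IsGenericWeight θ) {d e : V → ℕ}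
    (hd : weightValue θ d = 0) (he : weightValue θ e = 0) (hd0 : d ≠ 0) (he0 : e ≠ 0) :
    ∃ a b : ℕ, 0 < a ∧ 0 < b ∧ ∀ i, a * d i = b * e i := by
  let u : LinearMap.ker (Fintype.linearCombination ℤ θ) :=
    ⟨fun i => (d i : ℤ), by rw [LinearMap.mem_ker, linearCombination_eq_weightValue, hd]⟩
  let v : LinearMap.ker (Fintype.linearCombination ℤ θ) :=
    ⟨fun i => (e i : ℤ), by rw [LinearMap.mem_ker, linearCombination_eq_weightValue, he]⟩
  have hli : ¬ LinearIndependent ℤ ![u, v] := fun h => by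
    have := h.fintype_card_le_finrank
    rw [hθ] at this
    simp at this
  rw [LinearIndependent.pair_iff] at hli
  push Not at hli
  obtain ⟨s, t, hst, hne⟩ := hli
  have hi : ∀ i, s * d i + t * e i = 0 := fun i => congrFun (congrArg Subtype.val hst) i
  obtain ⟨i, hi0⟩ := Function.ne_iff.1 hd0
  obtain ⟨j, hj0⟩ := Function.ne_iff.1 he0
  have hs : s ≠ 0 := fun hs => hne hs (by simpa [hs, show e j ≠ 0 from hj0] using hi j)
  have ht : t ≠ 0 := fun ht => hs (by simpa [ht, show d i ≠ 0 from hi0] using hi i)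
  -- The relation reads `s d = -t e` with `d, e ≥ 0`, so absolute values give positive coefficients.
  refine ⟨s.natAbs, t.natAbs, Int.natAbs_pos.2 hs, Int.natAbs_pos.2 ht, fun k => ?_⟩
  have := congrArg Int.natAbs (eq_neg_of_add_eq_zero_left (hi k))
  simpa [Int.natAbs_mul] using this

/-- The weights orthogonal to `n`, as a linear functional. -/
def weightFunctional (n : V → ℤ) : (V → ℝ) →ₗ[ℝ] ℝ :=
  Fintype.linearCombination ℝ (fun i => (n i : ℝ))

theorem weightFunctional_apply (n : V → ℤ) (θ : V → ℝ) :
    weightFunctional n θ = Fintype.linearCombination ℤ θ n := by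
  simp [weightFunctional, Fintype.linearCombination_apply, mul_comm]

/-- At a zero `x` of `f`, the points `x + t • w` with `t ≠ 0` tend to `x` and satisfy `f (x + t • w)
= t * f w ≠ 0`. -/
theorem dense_setOf_apply_ne_zero {E : Type*} [NormedAddCommGroup E] [NormedSpace ℝ E]
    (f : E →ₗ[ℝ] ℝ) {w : E} (hw : f w ≠ 0) : Dense {x | f x ≠ 0} := by
  intro x
  by_cases hx : f x = 0
  · have hc : Tendsto (fun t : ℝ => x + t • w) (𝓝[≠] 0) (𝓝 x) := by
      have : Continuous fun t : ℝ => x + t • w := by fun_prop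
      simpa using (this.tendsto 0).mono_left nhdsWithin_le_nhds
    refine mem_closure_of_tendsto hc (eventually_nhdsWithin_of_forall fun t ht => ?_)
    simpa [hx, hw] using ht
  · exact subset_closure hx

theorem exists_apply_ne_zero {d n : V → ℤ} (h : ∃ i j, d i * n j ≠ d j * n i) :
    ∃ w ∈ LinearMap.ker (weightFunctional d), weightFunctional n w ≠ 0 := by
  obtain ⟨i, j, hij⟩ := h
  -- This weight pairs with any `m` to the minor `d i * m j - d j * m i`, which is zero for `m = d`.
  refine ⟨(d i : ℝ) • Pi.single j 1 - (d j : ℝ) • Pi.single i 1, ?_, ?_⟩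
  · simp [weightFunctional, Fintype.linearCombination_apply_single, mul_comm]
  · simp only [weightFunctional, map_sub, map_smul, Fintype.linearCombination_apply_single,
      smul_eq_mul, one_mul]
    rw [sub_ne_zero]
    exact_mod_cast hij

/-- The kernel contains `d` and only vectors proportional to it, so a coordinate `i` with `d i ≠ 0`
embeds the kernel into `ℤ`. -/
theorem isGenericWeight_of_forall {θ : V → ℝ} {d : V → ℤ} (hd0 : d ≠ 0)
    (hd : weightFunctional d θ = 0)
    (h : ∀ n : V → ℤ, (∃ i j, d i * n j ≠ d j * n i) → weightFunctional n θ ≠ 0) :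
    IsGenericWeight θ := by
  have hmem : d ∈ LinearMap.ker (Fintype.linearCombination ℤ θ) := by
    rw [LinearMap.mem_ker, ← weightFunctional_apply, hd]
  obtain ⟨i, hi⟩ := Function.ne_iff.1 hd0
  refine le_antisymm ?_ ?_
  · let f : LinearMap.ker (Fintype.linearCombination ℤ θ) →ₗ[ℤ] ℤ :=
      (LinearMap.proj i).comp (Submodule.subtype _)
    have hf : Function.Injective f := by
      refine (injective_iff_map_eq_zero f).2 fun n hn => Subtype.ext (funext fun j => ?_)
      by_contra hj
      refine h n.1 ⟨i, j, ?_⟩ (by rw [weightFunctional_apply]; exact n.2)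
      have hn' : n.1 i = 0 := hn
      rw [hn', mul_zero]
      exact mul_ne_zero hi hj
    simpa using LinearMap.finrank_le_finrank_of_injective hf
  · refine Module.finrank_pos_iff_exists_ne_zero.2 ⟨⟨d, hmem⟩, fun h0 => hd0 ?_⟩
    exact congrArg Subtype.val h0

/-- Generic weights are dense in `d^⊥`. -/
theorem mem_closure_isGenericWeight {d : V → ℤ} (hd0 : d ≠ 0) {s : V → ℝ}
    (hs : weightFunctional d s = 0) :
    s ∈ closure {θ | weightFunctional d θ = 0 ∧ IsGenericWeight θ} := by
  let E := LinearMap.ker (weightFunctional d)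
  let N := {n : V → ℤ // ∃ i j, d i * n j ≠ d j * n i}
  -- Baire: each of the countably many `n` not proportional to `d` cuts out a proper hyperplane of
  -- `d^⊥`, with open dense complement.
  have hdense : Dense (⋂ n : N, {θ : E | (weightFunctional n.1).domRestrict E θ ≠ 0}) := by
    refine dense_iInter_of_isOpen (fun n => ?_) fun n => ?_
    · exact isOpen_ne_fun (LinearMap.continuous_of_finiteDimensional _) continuous_const
    · obtain ⟨w, hw, hw'⟩ := exists_apply_ne_zero n.2
      exact dense_setOf_apply_ne_zero _ (w := (⟨w, hw⟩ : E)) hw'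
  have hmem := image_closure_subset_closure_image continuous_subtype_val
    (Set.mem_image_of_mem Subtype.val (hdense (⟨s, hs⟩ : E)))
  refine closure_mono ?_ hmem
  rintro _ ⟨θ, hθ, rfl⟩
  exact ⟨θ.2, isGenericWeight_of_forall hd0 θ.2 fun n hn => Set.mem_iInter.1 hθ ⟨n, hn⟩⟩

theorem weightFunctional_natCast (d : V → ℕ) (θ : V → ℝ) :
    weightFunctional (fun i => (d i : ℤ)) θ = weightValue θ d := by
  rw [weightFunctional_apply, linearCombination_eq_weightValue]

/-! ### The self-stability weight -/

theorem skewForm_eq (n d : V → ℤ) :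
    skewForm n d = ∑ i, ∑ j, (Fintype.card (i ⟶ j) : ℤ) * (d i * n j - n i * d j) := by
  simp only [skewForm, eulerForm, mul_sub, Finset.sum_sub_distrib, mul_comm (d _) (n _)]
  ring

theorem selfStability_apply (d : V →₀ ℕ) (k : V) :
    selfStability d k = ∑ j, (Fintype.card (j ⟶ k) : ℝ) * d j -
      ∑ j, (Fintype.card (k ⟶ j) : ℝ) * d j := by
  simp [selfStability, skewForm_eq, mul_sub, Finset.sum_sub_distrib, Pi.single_apply]

theorem weightValue_selfStability (d : V →₀ ℕ) (n : V → ℕ) :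
    weightValue (selfStability d) n =
      ∑ i, ∑ j, (Fintype.card (i ⟶ j) : ℝ) * (d i * n j - n i * d j) := by
  simp only [weightValue, selfStability_apply, sub_mul, mul_sub, Finset.sum_sub_distrib,
    Finset.sum_mul]
  rw [Finset.sum_comm]
  congr 1
  · exact Finset.sum_congr rfl fun i _ => Finset.sum_congr rfl fun j _ => by ring
  · exact Finset.sum_congr rfl fun i _ => Finset.sum_congr rfl fun j _ => by ring

/-- For the trivial filter every value would be an eventual value, and the choice in `attractorDT`
would be undetermined. -/
theorem attractorFilter_neBot {d : V →₀ ℕ} (hd : d ≠ 0) : (attractorFilter d).NeBot := by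
  have h0 : (fun i => (d i : ℤ)) ≠ 0 := fun h => hd (Finsupp.ext fun i => by
    exact Int.natCast_eq_zero.1 (congrFun h i))
  have hs : weightValue (selfStability d) d = 0 := by
    rw [weightValue_selfStability]
    simp
  have := mem_closure_isGenericWeight h0 ((weightFunctional_natCast d _).trans hs)
  simp only [weightFunctional_natCast] at this
  exact mem_closure_iff_nhdsWithin_neBot.1 this

theorem attractorDT_eq_of_eventually {A : (V → ℝ) → (V →₀ ℕ) → RatFunc ℚ} {d : V →₀ ℕ}
    (hd : d ≠ 0) {v : RatFunc ℚ} (h : ∀ᶠ θ in attractorFilter d, integerDT A θ d = v) :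
    attractorDT A d = v := by
  have := attractorFilter_neBot hd
  have hε : ∀ᶠ θ in attractorFilter d, integerDT A θ d = attractorDT A d :=
    Classical.epsilon_spec (p := fun v => ∀ᶠ θ in attractorFilter d, integerDT A θ d = v) ⟨v, h⟩
  obtain ⟨θ, h₁, h₂⟩ := (hε.and h).exists
  exact h₁.symm.trans h₂

/-! ### Destabilizing subrepresentations -/

/-- The restriction of a dimension vector to a set of vertices. -/
def restrictDim (I : Finset V) (d : V → ℕ) : V → ℕ := fun i => if i ∈ I then d i else 0

/-- If no arrow leaves `I` inside the support of `d`, then the part of a representation supported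
on `I` is a subrepresentation. -/
theorem not_isSemistable {θ : V → ℝ} {d : V →₀ ℕ} {I : Finset V}
    (hI : ∀ i j, i ∈ I → j ∉ I → d j ≠ 0 → IsEmpty (i ⟶ j))
    (hθ : 0 < weightValue θ (restrictDim I d)) (x : Coord d → ℂ) : ¬ IsSemistable θ d x := by
  intro hx
  have h := hx.2 (fun i => if i ∈ I then ⊤ else ⊥) fun i j a => ?_
  · refine absurd hθ (not_lt.2 ?_)
    have hN : (fun i => Module.finrank ℂ (if i ∈ I then ⊤ else ⊥ : Submodule ℂ (Fin (d i) → ℂ))) =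
        restrictDim I d := by
      funext i
      by_cases hi : i ∈ I
      · rw [if_pos hi, finrank_top, Module.finrank_fin_fun, restrictDim, if_pos hi]
      · rw [if_neg hi, finrank_bot, restrictDim, if_neg hi]
    rwa [hN] at h
  · by_cases hi : i ∈ I
    · by_cases hj : j ∈ I
      · simp [hj]
      · by_cases hdj : d j = 0
        · have : IsEmpty (Fin (d j)) := by rw [hdj]; infer_instance
          exact fun y _ => by rw [Subsingleton.elim y 0]; exact zero_mem _
        · exact ((hI i j hi hj hdj).false a).elim
    · simp [hi]

theorem weightValue_restrictDim_add (θ : V → ℝ) (I : Finset V) (d : V → ℕ) :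
    weightValue θ (restrictDim I d) + weightValue θ (restrictDim Iᶜ d) = weightValue θ d := by
  simp only [weightValue, ← Finset.sum_add_distrib]
  refine Finset.sum_congr rfl fun i _ => ?_
  by_cases hi : i ∈ I <;> simp [restrictDim, hi]

theorem weightValue_restrictDim_of_mul_eq (θ : V → ℝ) (I : Finset V) {d e : V → ℕ} {a b : ℕ}
    (h : ∀ i, a * d i = b * e i) :
    a * weightValue θ (restrictDim I d) = b * weightValue θ (restrictDim I e) := by
  simp only [weightValue, Finset.mul_sum]
  refine Finset.sum_congr rfl fun i _ => ?_
  have hi : (a * d i : ℝ) = b * e i := by exact_mod_cast h i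
  by_cases hI : i ∈ I
  · simp only [restrictDim, hI, if_true]
    linear_combination θ i * hi
  · simp [restrictDim, hI]

/-- A destabilizing set of vertices for `d` destabilizes every `e ≠ 0` with `θ(e) = 0`. -/
theorem IsGenericWeight.not_isSemistable {θ : V → ℝ} (hg : IsGenericWeight θ) {d e : V →₀ ℕ}
    (hd0 : d ≠ 0) (he0 : e ≠ 0) (hd : weightValue θ d = 0) (he : weightValue θ e = 0)
    {I : Finset V} (hI : ∀ i j, i ∈ I → j ∉ I → d j ≠ 0 → IsEmpty (i ⟶ j))
    (hθ : 0 < weightValue θ (restrictDim I d)) (x : Coord e → ℂ) : ¬ IsSemistable θ e x := by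
  obtain ⟨a, b, ha, hb, hab⟩ := hg.exists_mul_eq hd he (fun h => hd0 (DFunLike.coe_injective h))
    fun h => he0 (DFunLike.coe_injective h)
  -- As `a * d = b * e` with `a, b > 0`, the vectors `d` and `e` have the same support, and
  -- `θ(d|_I)` and `θ(e|_I)` have the same sign.
  refine AttractorDT.not_isSemistable (I := I) (fun i j hi hj hej => hI i j hi hj fun hdj => hej ?_)
    ?_ x
  · have := hab j
    rw [hdj, mul_zero] at this
    exact (mul_eq_zero.1 this.symm).resolve_left hb.ne'
  · have h := weightValue_restrictDim_of_mul_eq θ I hab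
    have ha' : (0 : ℝ) < a := by exact_mod_cast ha
    have hb' : (0 : ℝ) < b := by exact_mod_cast hb
    exact pos_of_mul_pos_right (h ▸ mul_pos ha' hθ) hb'.le

/-- Otherwise genericity would make `d|_I` proportional to `d`, but it vanishes at `j` while `d`
does not. -/
theorem IsGenericWeight.weightValue_restrictDim_ne_zero {θ : V → ℝ} (hg : IsGenericWeight θ)
    {d : V →₀ ℕ} (hd : weightValue θ d = 0) {I : Finset V} {i j : V} (hi : i ∈ I) (hj : j ∉ I)
    (hdi : d i ≠ 0) (hdj : d j ≠ 0) : weightValue θ (restrictDim I d) ≠ 0 := by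
  intro h
  obtain ⟨a, b, ha, -, hab⟩ := hg.exists_mul_eq hd h (fun h => hdi (congrFun h i))
    fun h => hdi (by simpa [restrictDim, hi] using congrFun h i)
  have := hab j
  simp [restrictDim, hj, ha.ne', hdj] at this

/-- Arrows inside `I` or outside `I` contribute zero, arrows leaving `I` contribute nothing by `hI`,
and an arrow `k ⟶ l` entering `I` contributes `d k * d l`. -/
theorem weightValue_selfStability_restrictDim_pos {d : V →₀ ℕ} {I : Finset V}
    (hI : ∀ i j, i ∈ I → j ∉ I → d j ≠ 0 → IsEmpty (i ⟶ j)) {i j : V} (hi : i ∉ I) (hj : j ∈ I)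
    (hdi : d i ≠ 0) (hdj : d j ≠ 0) (a : i ⟶ j) :
    0 < weightValue (selfStability d) (restrictDim I d) := by
  rw [weightValue_selfStability]
  have hnn : ∀ k l, 0 ≤ (Fintype.card (k ⟶ l) : ℝ) *
      (d k * (restrictDim I d l : ℕ) - (restrictDim I d k : ℕ) * d l) := fun k l => by
    by_cases hk : k ∈ I <;> by_cases hl : l ∈ I
    · simp [restrictDim, hk, hl]
    · by_cases hdl : d l = 0
      · simp [restrictDim, hdl]
      · have := hI k l hk hl hdl
        simp
    · simp only [restrictDim, hk, hl, if_true, if_false, Nat.cast_zero, zero_mul, sub_zero]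
      positivity
    · simp [restrictDim, hk, hl]
  refine Finset.sum_pos' (fun k _ => Finset.sum_nonneg fun l _ => hnn k l)
    ⟨i, Finset.mem_univ _, Finset.sum_pos' (fun l _ => hnn i l) ⟨j, Finset.mem_univ _, ?_⟩⟩
  have : 0 < Fintype.card (i ⟶ j) := Fintype.card_pos_iff.2 ⟨a⟩
  have := Nat.pos_of_ne_zero hdi
  have := Nat.pos_of_ne_zero hdj
  simp only [restrictDim, hi, hj, if_true, if_false, Nat.cast_zero, zero_mul, sub_zero]
  positivity

theorem exists_closed_of_not_isStronglyConnected {d : V →₀ ℕ}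
    (hd : ¬ Quiver.IsStronglyConnected (SuppQuiver d)) :
    ∃ I : Finset V, (∃ i ∈ I, d i ≠ 0) ∧ (∃ j ∉ I, d j ≠ 0) ∧
      ∀ i j, i ∈ I → j ∉ I → d j ≠ 0 → IsEmpty (i ⟶ j) := by
  classical
  simp only [Quiver.IsStronglyConnected, not_forall, not_nonempty_iff] at hd
  obtain ⟨i, j, hij⟩ := hd
  -- The vertices reachable from `i` within the support; `j` is not among them.
  let I : Finset V := {k | ∃ h : k ∈ d.support, Nonempty (Quiver.Path i (⟨k, h⟩ : SuppQuiver d))}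
  have hI : ∀ k, k ∈ I ↔
      ∃ h : k ∈ d.support, Nonempty (Quiver.Path i (⟨k, h⟩ : SuppQuiver d)) := fun k => by simp [I]
  refine ⟨I, ⟨i.1, (hI _).2 ⟨i.2, ⟨.nil⟩⟩, Finsupp.mem_support_iff.1 i.2⟩,
    ⟨j.1, fun h => ?_, Finsupp.mem_support_iff.1 j.2⟩, fun k l hk hl hdl => ⟨fun a => hl ?_⟩⟩
  · obtain ⟨_, ⟨p⟩⟩ := (hI _).1 h
    exact hij.false p
  · obtain ⟨_, ⟨p⟩⟩ := (hI _).1 hk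
    exact (hI _).2 ⟨Finsupp.mem_support_iff.2 hdl, ⟨p.cons a⟩⟩

theorem continuous_weightValue (n : V → ℕ) : Continuous fun θ : V → ℝ => weightValue θ n := by
  unfold weightValue
  fun_prop

/-- Near the self-stability weight, generic weights in `d^⊥` admit no semistable representations of
dimension vectors `e ≠ 0` with `θ(e) = 0`. -/
theorem eventually_not_isSemistable {d : V →₀ ℕ}
    (hd : ¬ Quiver.IsStronglyConnected (SuppQuiver d)) :
    ∀ᶠ θ in attractorFilter d, ∀ e : V →₀ ℕ, e ≠ 0 → weightValue θ e = 0 →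
      ∀ x, ¬ IsSemistable θ e x := by
  obtain ⟨I, ⟨i, hi, hdi⟩, ⟨j, hj, hdj⟩, hI⟩ := exists_closed_of_not_isStronglyConnected hd
  have hd0 : d ≠ 0 := fun h => hdi (by simp [h])
  have hmem : ∀ᶠ θ in attractorFilter d, weightValue θ d = 0 ∧ IsGenericWeight θ :=
    eventually_mem_nhdsWithin
  by_cases harr : ∃ k l, k ∉ I ∧ l ∈ I ∧ d k ≠ 0 ∧ d l ≠ 0 ∧ Nonempty (k ⟶ l)
  · obtain ⟨k, l, hk, hl, hdk, hdl, ⟨a⟩⟩ := harr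
    have hpos : ∀ᶠ θ in attractorFilter d, 0 < weightValue θ (restrictDim I d) :=
      ((continuous_weightValue _).continuousAt.eventually (lt_mem_nhds
        (weightValue_selfStability_restrictDim_pos hI hk hl hdk hdl a))).filter_mono
        nhdsWithin_le_nhds
    filter_upwards [hmem, hpos] with θ hθ hp e he0 he
    exact hθ.2.not_isSemistable hd0 he0 hθ.1 he hI hp
  -- Here `⟨d|_I, d⟩ = 0`, so the sign of `θ(d|_I)` depends on the perturbation; `I` and the rest of
  -- the support are both closed under arrows within the support.
  · push Not at harr
    filter_upwards [hmem] with θ hθ e he0 he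
    rcases (hθ.2.weightValue_restrictDim_ne_zero hθ.1 hi hj hdi hdj).lt_or_gt with hneg | hp
    -- Vertices outside the support may have arrows into `I`, so the complement is cut down to the
    -- support, which does not change the restricted dimension vector.
    · refine hθ.2.not_isSemistable hd0 he0 hθ.1 he (I := Iᶜ ∩ d.support) (fun k l hk hl hdl => ?_) ?_
      · simp only [Finset.mem_inter, Finset.mem_compl, Finsupp.mem_support_iff, not_and] at hk hl
        have hlI : l ∈ I := by_contra fun h => hl h hdl
        exact harr k l hk.1 hlI hk.2 hdl
      · have h := weightValue_restrictDim_add θ I d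
        have hr : restrictDim (Iᶜ ∩ d.support) d = restrictDim Iᶜ d := by
          funext k
          by_cases hk : d k = 0 <;> simp [restrictDim, hk]
        rw [hr]
        linarith [hθ.1]
    · exact hθ.2.not_isSemistable hd0 he0 hθ.1 he hI hp

end QuiverWithPotential

end AttractorDT

theorem mainTheorem2 {V : Type} [Fintype V] [DecidableEq V] [Quiver.{0} V]
    [∀ i j : V, Fintype (i ⟶ j)] (W : AttractorDT.Potential V) (d : V →₀ ℕ)
    (hd : ¬ Quiver.IsStronglyConnected (AttractorDT.SuppQuiver d)) :
    (AttractorDT.attractorDT (AttractorDT.stackyDT W) d = 0 ∧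
      ∀ᶠ θ in AttractorDT.attractorFilter d,
        AttractorDT.integerDT (AttractorDT.stackyDT W) θ d = 0) ∧
    (AttractorDT.attractorDT (AttractorDT.criticalStackyDT W) d = 0 ∧
      ∀ᶠ θ in AttractorDT.attractorFilter d,
        AttractorDT.integerDT (AttractorDT.criticalStackyDT W) θ d = 0) := by
  have hd0 : d ≠ 0 := fun h => by
    obtain ⟨-, ⟨i, -, hi⟩, -⟩ := AttractorDT.exists_closed_of_not_isStronglyConnected hd
    exact hi (by simp [h])
  have hss := AttractorDT.eventually_not_isSemistable hd
  have h₁ : ∀ᶠ θ in AttractorDT.attractorFilter d,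
      AttractorDT.integerDT (AttractorDT.stackyDT W) θ d = 0 :=
    hss.mono fun θ hθ => AttractorDT.integerDT_eq_zero
      (fun e he0 he => AttractorDT.stackyDT_eq_zero W (hθ e he0 he)) hd0
  have h₂ : ∀ᶠ θ in AttractorDT.attractorFilter d,
      AttractorDT.integerDT (AttractorDT.criticalStackyDT W) θ d = 0 :=
    hss.mono fun θ hθ => AttractorDT.integerDT_eq_zero
      (fun e he0 he => AttractorDT.criticalStackyDT_eq_zero W (hθ e he0 he)) hd0
  exact ⟨⟨AttractorDT.attractorDT_eq_of_eventually hd0 h₁, h₁⟩,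
    AttractorDT.attractorDT_eq_of_eventually hd0 h₂, h₂⟩
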